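/- **Setting.** Let $B$ be an optimization problem over a universe $\mathcal U$ of input items. An input is a finite set $I\subset\mathcal U$ satisfying a consistency condition; a solution of $I$ is an accept/reject decision for each item of $I$ (some solutions may be infeasible), and feasible solutions have a nonnegative objective value (a cost to be minimized or a profit to be maximized). $\mathrm{OPT}(I)$ is the best value of a feasible solution. The objective function is *additive*: if $I_1,I_2$ are disjoint inputs whose union is an input, then the feasible solutions of $I_1\cup I_2$ are exactly the combinations of feasible solutions of $I_1$ and of $I_2$, and their values add up (so that $\mathrm{OPT}(I_1\cup I_2)=\mathrm{OPT}(I_1)+\mathrm{OPT}(I_2)$). A *fixed priority algorithm with advice* $\mathrm{ALG}$ has an injective priority function $P:\mathcal U\to\mathbb R$ and an oracle that sees the whole input and writes an infinite tape of bits. The items of the input are presented in order of decreasing priority; $\mathrm{ALG}$ decides irrevocably on each item when it arrives, on the basis of the items that have arrived so far and of the bits it has read from the tape. $\mathrm{ALG}$ *reads fewer than $f(n)$ advice bits* if, for all sufficiently large $n$, it reads fewer than $f(n)$ bits on every input consisting of $n$ items. It is $c$-competitive if there is a constant $\alpha$ such that on every input $I$ for which $\mathrm{OPT}(I)$ exists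 its solution is feasible and its value $\mathrm{ALG}(I)$ satisfies $\mathrm{ALG}(I)\le c\,\mathrm{OPT}(I)+\alpha$ (minimization), respectively $\mathrm{OPT}(I)\le c\,\mathrm{ALG}(I)+\alpha$ (maximization). Its *approximation ratio* is the infimum of all such $c$ ($+\infty$ if there is none). For an input $G$ with highest-priority item $m$, $\mathrm{BAD}(G)$ is the best value of a feasible solution of $G$ whose decision on $m$ is the opposite of the one made in an optimal solution. **Gadgets.** Suppose that for each $x\in\mathbb Q\cap[0,\frac12]$ there is a pair $(G_x^1,G_x^2)$ of inputs of $B$ such that: 1. $G_x^1$ and $G_x^2$ have the same highest-priority item $m_1(x)$ with respect to $P$; 2. the decision on $m_1(x)$ in any optimal solution of $G_x^1$ differs from the decision on $m_1(x)$ in any optimal solution of $G_x^2$; 3. every gadget consists of at most $s$ items; 4. for $x\ne y$ and $i,j\in\{1,2\}$, $G_x^i$ and $G_y^j$ are disjoint, and the union of finitely many (at least one) gadgets belonging to different $x$ is an input of $B$; 5. for $i\in\{1,2\}$ the values $\mathrm{OPT}(G_x^i)$ and $\mathrm{BAD}(G_x^i)$ exist and do not depend on $x$; denote them by $\mathrm{OPT}(G^i)$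 and $\mathrm{BAD}(G^i)$. Let $H(p)=-p\log_2 p-(1-p)\log_2(1-p)$ and let $\epsilon\in(0,\frac12)$. **Claim.** Suppose that $\mathrm{ALG}$ reads fewer than $(1-H(\epsilon))\,n/(2s)$ advice bits. * If $B$ is a minimization problem, $\mathrm{OPT}(G^1)>0$ and $\mathrm{OPT}(G^1)=\mathrm{OPT}(G^2)=\mathrm{BAD}(G^1)-1=\mathrm{BAD}(G^2)-1$, then the approximation ratio of $\mathrm{ALG}$ is at least $1+\dfrac{\epsilon}{\mathrm{OPT}(G^1)}$. * If $B$ is a maximization problem and $\mathrm{OPT}(G^1)=\mathrm{OPT}(G^2)=\mathrm{BAD}(G^1)+1=\mathrm{BAD}(G^2)+1$, then the approximation ratio of $\mathrm{ALG}$ is at least $1+\dfrac{\epsilon}{\mathrm{OPT}(G^1)-\epsilon}$. -/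

import Mathlib

namespace PriorityAdvice

/-- Whether the objective function is a cost to be minimized or a profit to be maximized. -/
inductive Goal where
  | minimize
  | maximize

/-- `v` is the best value in the set `S` of attainable objective values (and it is attained). -/
def IsBest : Goal → Set ℝ → ℝ → Prop
  | Goal.minimize, S, v => IsLeast S v
  | Goal.maximize, S, v => IsGreatest S v

/-- An optimization problem with accept/reject decisions over a universe `U` of input items.
An input is a finite set of items satisfying a consistency condition. A solution of the input `I`
is given by the set `A ⊆ I` of accepted items; some solutions may be infeasible. Costs and profits
are nonnegative. -/
structure Problem (U : Type*) where
  goal : Goal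
  /-- the consistency condition on inputs -/
  IsInstance : Finset U → Prop
  /-- `Feasible I A`: accepting exactly the items `A` of the input `I` is a feasible solution -/
  Feasible : Finset U → Finset U → Prop
  /-- the objective function -/
  obj : Finset U → Finset U → ℝ
  obj_nonneg : ∀ I A, IsInstance I → A ⊆ I → Feasible I A → 0 ≤ obj I A

namespace Problem

variable {U : Type*}

/-- `v = OPT(I)`. -/
def IsOpt (B : Problem U) (I : Finset U) (v : ℝ) : Prop :=
  IsBest B.goal {w | ∃ A ⊆ I, B.Feasible I A ∧ w = B.obj I A} v

/-- Accepting exactly the items `A` is an optimal solution of the input `I`. -/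
def IsOptimalSolution (B : Problem U) (I A : Finset U) : Prop :=
  A ⊆ I ∧ B.Feasible I A ∧ B.IsOpt I (B.obj I A)

/-- `v = BAD(I)`, where `m` is the first item of `I`: there is an optimal solution `A` such that
`v` is the best value attainable on `I` given that the decision on `m` is the opposite of the
decision made in `A`. -/
def IsBad (B : Problem U) (I : Finset U) (m : U) (v : ℝ) : Prop :=
  ∃ A, B.IsOptimalSolution I A ∧
    IsBest B.goal
      {w | ∃ A' ⊆ I, B.Feasible I A' ∧ ¬ (m ∈ A' ↔ m ∈ A) ∧ w = B.obj I A'} v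

/-- The objective function is additive: whenever an input is the union of two disjoint inputs, its
solutions are the combinations of the solutions of the two parts, and values add up. -/
def Additive [DecidableEq U] (B : Problem U) : Prop :=
  ∀ I₁ I₂ A₁ A₂ : Finset U,
    B.IsInstance I₁ → B.IsInstance I₂ → B.IsInstance (I₁ ∪ I₂) → Disjoint I₁ I₂ →
    A₁ ⊆ I₁ → A₂ ⊆ I₂ →
    (B.Feasible (I₁ ∪ I₂) (A₁ ∪ A₂) ↔ B.Feasible I₁ A₁ ∧ B.Feasible I₂ A₂) ∧
    (B.Feasible I₁ A₁ → B.Feasible I₂ A₂ →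
      B.obj (I₁ ∪ I₂) (A₁ ∪ A₂) = B.obj I₁ A₁ + B.obj I₂ A₂)

end Problem

/-- A (deterministic) fixed priority algorithm with advice.

Items are presented in the order of decreasing priority, so the set of the items that have arrived
so far determines the order in which they arrived, and the last one. `answer φ H` is the decision
(`true` = accept) on the last arriving item of `H`, when the items that have arrived so far
(including this last one) are those of `H` and the advice tape is `φ`. `bits φ H` is the number of
bits of the tape that the algorithm has read, from left to right, after deciding on all items of
`H`. -/
structure FixedPriorityAlgorithm (U : Type*) where
  /-- the priority function; larger priority means earlier arrival -/
  prio : U → ℝ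
  prio_injective : Function.Injective prio
  /-- the oracle sees the entire input and writes the infinite advice tape -/
  oracle : Finset U → (ℕ → Bool)
  answer : (ℕ → Bool) → Finset U → Bool
  bits : (ℕ → Bool) → Finset U → ℕ
  /-- what the algorithm does depends only on the advice bits that it has read -/
  depends_on_read : ∀ (φ ψ : ℕ → Bool) (H : Finset U), (∀ i < bits φ H, φ i = ψ i) →
    bits ψ H = bits φ H ∧ answer ψ H = answer φ H
  /-- the number of bits read does not decrease while items arrive -/
  bits_mono : ∀ (φ : ℕ → Bool) (H : Finset U) (u : U),
    bits φ (H.filter (fun v => prio u ≤ prio v)) ≤ bits φ H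

namespace FixedPriorityAlgorithm

variable {U : Type*}

/-- The set of items of the input `I` that the algorithm accepts: the decision on `u ∈ I` is made
when exactly the items of `I` whose priority is at least that of `u` have arrived. -/
noncomputable def accepted (ALG : FixedPriorityAlgorithm U) (I : Finset U) : Finset U :=
  I.filter (fun u =>
    ALG.answer (ALG.oracle I) (I.filter (fun v => ALG.prio u ≤ ALG.prio v)) = true)

/-- The number of advice bits read on the input `I`. -/
def bitsRead (ALG : FixedPriorityAlgorithm U) (I : Finset U) : ℕ :=
  ALG.bits (ALG.oracle I) I

/-- For all large `n`, the algorithm reads fewer than `f n` advice bits on every input of `B`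
that consists of `n` items. -/
def ReadsFewerThan (ALG : FixedPriorityAlgorithm U) (B : Problem U) (f : ℕ → ℝ) : Prop :=
  ∀ᶠ n : ℕ in Filter.atTop, ∀ I : Finset U, B.IsInstance I → I.card = n →
    (ALG.bitsRead I : ℝ) < f n

/-- `a ≤ c * v + α` for costs and `v ≤ c * a + α` for profits, where `a` is the value of the
algorithm and `v` is the optimal value. -/
def RatioBound : Goal → (c α a v : ℝ) → Prop
  | Goal.minimize, c, α, a, v => a ≤ c * v + α
  | Goal.maximize, c, α, a, v => v ≤ c * a + α

/-- The algorithm is `c`-competitive (a `c`-approximation, asymptotically) for `B`. -/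
def IsCompetitive (ALG : FixedPriorityAlgorithm U) (B : Problem U) (c : ℝ) : Prop :=
  ∃ α : ℝ, ∀ (I : Finset U) (v : ℝ), B.IsInstance I → B.IsOpt I v →
    B.Feasible I (ALG.accepted I) ∧ RatioBound B.goal c α (B.obj I (ALG.accepted I)) v

/-- The (asymptotic) approximation ratio: the infimum of all `c` such that the algorithm is
`c`-competitive (`⊤` if there is no such `c`). -/
noncomputable def approxRatio (ALG : FixedPriorityAlgorithm U) (B : Problem U) : EReal :=
  sInf {x : EReal | ∃ c : ℝ, ALG.IsCompetitive B c ∧ x = (c : EReal)}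

end FixedPriorityAlgorithm

/-- The index set `ℚ ∩ [0, 1/2]` of the gadget pairs. -/
abbrev PairIndex : Type := Set.Icc (0 : ℚ) (1 / 2)

/-- The gadget conditions with respect to the priority function `P`. The pair of gadgets of `x` is
`(G x 0, G x 1)`, its first item is `m x`, gadgets have at most `s` items, and `opt i`, `bad i` are
the common values of `OPT` and `BAD` of all gadgets `G x i`. -/
structure IsGadgetFamily {U : Type*} [DecidableEq U] (B : Problem U) (P : U → ℝ)
    (G : PairIndex → Fin 2 → Finset U) (m : PairIndex → U) (s : ℕ)
    (opt bad : Fin 2 → ℝ) : Prop where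
  /-- gadgets of different pairs can be put together to form an input (in particular, each gadget
  is an input) -/
  isInstance : ∀ (T : Finset PairIndex) (k : PairIndex → Fin 2), T.Nonempty →
    B.IsInstance (T.biUnion (fun x => G x (k x)))
  /-- first item condition -/
  first_mem : ∀ x i, m x ∈ G x i
  first_max : ∀ x i, ∀ u ∈ G x i, P u ≤ P (m x)
  /-- distinguishing decision condition -/
  distinguishing : ∀ x A₁ A₂, B.IsOptimalSolution (G x 0) A₁ → B.IsOptimalSolution (G x 1) A₂ →
    ¬ (m x ∈ A₁ ↔ m x ∈ A₂)
  /-- size condition -/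
  size : ∀ x i, (G x i).card ≤ s
  /-- disjoint copies condition -/
  disjoint : ∀ x y, x ≠ y → ∀ i j, Disjoint (G x i) (G y j)
  /-- `OPT` and `BAD` condition -/
  isOpt : ∀ x i, B.IsOpt (G x i) (opt i)
  isBad : ∀ x i, B.IsBad (G x i) (m x) (bad i)

/-- The binary entropy function, with logarithms to base 2. -/
noncomputable def H (p : ℝ) : ℝ :=
  -p * Real.logb 2 p - (1 - p) * Real.logb 2 (1 - p)

end PriorityAdvice

namespace PriorityAdvice

open Finset

/-! Inputs built from `N` pairs correspond to the subsets `K` of the set of pairs: `K` says which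
gadget of each pair is used. Such an input can be decoded from the advice read and the set of pairs
on whose first item the algorithm errs (`eq_of_errors_eq`). Indeed, at the first pair where two
choices differ, the algorithm has seen the same items and bits, so it decides alike, while the
correct decisions are opposite. If at most `ε * N` errors were always made, there would be at most
`2 ^ (H ε * N)` error sets (`card_filter_powerset_le`). Together with at most `(1 - H ε) * N / 2`
advice bits they would encode `2 ^ N` inputs, which is too many (`exists_errors_gt`). So some input
forces more than `ε * N` errors. By additivity each error costs at least one (`sign_mul_obj_ge`),
against an optimum of `N * opt 0`. Letting `N` grow removes the additive constant. -/

/-- The sign by which values are multiplied so that smaller is better. -/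
def Goal.sign : Goal → ℝ
  | Goal.minimize => 1
  | Goal.maximize => -1

theorem isBest_iff (g : Goal) (S : Set ℝ) (v : ℝ) :
    IsBest g S v ↔ v ∈ S ∧ ∀ w ∈ S, g.sign * v ≤ g.sign * w := by
  cases g <;> simp [IsBest, IsLeast, IsGreatest, Goal.sign, lowerBounds, upperBounds]

/-! ### Binary entropy and the size of Hamming balls -/

theorem H_eq_binEntropy (p : ℝ) : H p = Real.binEntropy p / Real.log 2 := by
  simp only [H, Real.binEntropy, Real.logb, Real.log_inv]
  ring

theorem H_lt_one {ε : ℝ} (hε : ε ≠ 1 / 2) : H ε < 1 := by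
  rw [H_eq_binEntropy, div_lt_one (Real.log_pos one_lt_two)]
  exact Real.binEntropy_lt_log_two.2 (by simpa using hε)

theorem two_rpow_neg_H_mul {ε : ℝ} (h₀ : 0 < ε) (h₁ : ε < 1) (N : ℝ) :
    (2 : ℝ) ^ (-(H ε * N)) = ε ^ (ε * N) * (1 - ε) ^ ((1 - ε) * N) := by
  have h₂ : 0 < 1 - ε := by linarith
  have hl : Real.log 2 ≠ 0 := (Real.log_pos one_lt_two).ne'
  rw [Real.rpow_def_of_pos two_pos, Real.rpow_def_of_pos h₀, Real.rpow_def_of_pos h₂,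
    ← Real.exp_add]
  congr 1
  simp only [H, Real.logb]
  field_simp
  ring

/-- The Hamming ball of radius `ε * N` in the cube of dimension `N` has at most `2 ^ (H ε * N)`
elements. -/
theorem card_filter_powerset_le {ι : Type*} (T : Finset ι) {ε : ℝ} (h₀ : 0 < ε)
    (h₁ : ε < 1 / 2) :
    ((T.powerset.filter (fun e => (e.card : ℝ) ≤ ε * T.card)).card : ℝ) ≤
      (2 : ℝ) ^ (H ε * T.card) := by
  have h₂ : 0 < 1 - ε := by linarith
  -- Include each element independently with probability `ε`: the weights of all subsets sum to one,
  -- and each set in the ball has weight at least `2 ^ (-(H ε * N))`, where `N = T.card`.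
  have hsum := Finset.sum_pow_mul_eq_add_pow ε (1 - ε) T
  rw [add_sub_cancel, one_pow] at hsum
  have hterm : ∀ e ∈ T.powerset.filter (fun e => (e.card : ℝ) ≤ ε * T.card),
      (2 : ℝ) ^ (-(H ε * T.card)) ≤ ε ^ e.card * (1 - ε) ^ (T.card - e.card) := by
    intro e he
    rw [mem_filter, mem_powerset] at he
    have hle : e.card ≤ T.card := card_le_card he.1
    rw [two_rpow_neg_H_mul h₀ (by linarith), ← Real.rpow_natCast, ← Real.rpow_natCast,
      Nat.cast_sub hle]
    have hA : ε ^ (ε * T.card) = ε ^ (e.card : ℝ) * ε ^ (ε * T.card - e.card) := by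
      rw [← Real.rpow_add h₀]; congr 1; ring
    have hB : (1 - ε) ^ ((T.card : ℝ) - e.card) =
        (1 - ε) ^ ((1 - ε) * T.card) * (1 - ε) ^ (ε * T.card - e.card) := by
      rw [← Real.rpow_add h₂]; congr 1; ring
    rw [hA, hB]
    -- Here `ε < 1 - ε`, and the exponent is nonnegative because `e` lies in the ball.
    have hC : ε ^ (ε * T.card - e.card) ≤ (1 - ε) ^ (ε * T.card - e.card) :=
      Real.rpow_le_rpow h₀.le (by linarith) (by linarith [he.2])
    calc _ = ε ^ (e.card : ℝ) * (1 - ε) ^ ((1 - ε) * T.card) * ε ^ (ε * T.card - e.card) := by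
          ring
      _ ≤ ε ^ (e.card : ℝ) * (1 - ε) ^ ((1 - ε) * T.card) * (1 - ε) ^ (ε * T.card - e.card) := by
          gcongr
      _ = _ := by ring
  have h := Finset.sum_le_sum hterm
  have h' := Finset.sum_le_sum_of_subset_of_nonneg
    (filter_subset (fun e => (e.card : ℝ) ≤ ε * T.card) T.powerset)
    (f := fun e => ε ^ e.card * (1 - ε) ^ (T.card - e.card))
    (fun e _ _ => by positivity)
  rw [hsum] at h'
  rw [sum_const, nsmul_eq_mul] at h
  have h₃ := h.trans h'
  rwa [Real.rpow_neg two_pos.le, ← div_eq_mul_inv, div_le_one (by positivity)] at h₃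

/-! ### Unions of gadgets -/

section Gadgets

variable {U : Type*} [DecidableEq U] {B : Problem U} {P : U → ℝ}
  {G : PairIndex → Fin 2 → Finset U} {m : PairIndex → U} {s : ℕ} {opt bad : Fin 2 → ℝ}

/-- The input that consists of the gadgets `G x (k x)` for `x ∈ T`. -/
def gadgetUnion (G : PairIndex → Fin 2 → Finset U) (T : Finset PairIndex)
    (k : PairIndex → Fin 2) : Finset U :=
  T.biUnion (fun x => G x (k x))

/-- The decision on the first item of `G x i` in some optimal solution is to accept. -/
def OptAccepts (B : Problem U) (G : PairIndex → Fin 2 → Finset U) (m : PairIndex → U)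
    (x : PairIndex) (i : Fin 2) : Prop :=
  ∃ A, B.IsOptimalSolution (G x i) A ∧ m x ∈ A

namespace IsGadgetFamily

theorem isInstance_gadget (hG : IsGadgetFamily B P G m s opt bad) (x : PairIndex) (i : Fin 2) :
    B.IsInstance (G x i) := by
  simpa using hG.isInstance {x} (fun _ => i) (singleton_nonempty x)

theorem exists_isOptimalSolution (hG : IsGadgetFamily B P G m s opt bad) (x : PairIndex)
    (i : Fin 2) : ∃ A, B.IsOptimalSolution (G x i) A := by
  obtain ⟨A, hA, -⟩ := hG.isBad x i
  exact ⟨A, hA⟩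

/-- Two optimal solutions of one gadget both disagree with any optimal solution of its partner, so
they agree with each other. This makes the correct decision well defined. -/
theorem mem_iff_optAccepts (hG : IsGadgetFamily B P G m s opt bad) {x : PairIndex} {i : Fin 2}
    {A : Finset U} (hA : B.IsOptimalSolution (G x i) A) : m x ∈ A ↔ OptAccepts B G m x i := by
  refine ⟨fun h => ⟨A, hA, h⟩, ?_⟩
  rintro ⟨A', hA', hm⟩
  fin_cases i
  · obtain ⟨C, hC⟩ := hG.exists_isOptimalSolution x 1
    have h₁ := hG.distinguishing x A C hA hC
    have h₂ := hG.distinguishing x A' C hA' hC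
    tauto
  · obtain ⟨C, hC⟩ := hG.exists_isOptimalSolution x 0
    have h₁ := hG.distinguishing x C A hC hA
    have h₂ := hG.distinguishing x C A' hC hA'
    tauto

theorem eq_of_optAccepts_iff (hG : IsGadgetFamily B P G m s opt bad) {x : PairIndex}
    {i j : Fin 2} (h : OptAccepts B G m x i ↔ OptAccepts B G m x j) : i = j := by
  obtain ⟨A, hA⟩ := hG.exists_isOptimalSolution x 0
  obtain ⟨C, hC⟩ := hG.exists_isOptimalSolution x 1
  have hd := hG.distinguishing x A C hA hC
  rw [hG.mem_iff_optAccepts hA, hG.mem_iff_optAccepts hC] at hd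
  fin_cases i <;> fin_cases j <;> first | rfl | (exfalso; simp at h hd; tauto)

theorem sign_mul_opt_le (hG : IsGadgetFamily B P G m s opt bad) {x : PairIndex} {i : Fin 2}
    {A : Finset U} (hA : A ⊆ G x i) (hf : B.Feasible (G x i) A) :
    B.goal.sign * opt i ≤ B.goal.sign * B.obj (G x i) A :=
  ((isBest_iff _ _ _).1 (hG.isOpt x i)).2 _ ⟨A, hA, hf, rfl⟩

theorem sign_mul_bad_le (hG : IsGadgetFamily B P G m s opt bad) {x : PairIndex} {i : Fin 2}
    {A : Finset U} (hA : A ⊆ G x i) (hf : B.Feasible (G x i) A)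
    (hm : ¬ (m x ∈ A ↔ OptAccepts B G m x i)) :
    B.goal.sign * bad i ≤ B.goal.sign * B.obj (G x i) A := by
  obtain ⟨C, hC, hbest⟩ := hG.isBad x i
  rw [← hG.mem_iff_optAccepts hC] at hm
  exact ((isBest_iff _ _ _).1 hbest).2 _ ⟨A, hA, hf, hm, rfl⟩

/-- For maximization this gives `opt 0 ≥ 1`, so that `opt 0 - ε` is a positive denominator. -/
theorem bad_nonneg (hG : IsGadgetFamily B P G m s opt bad) (i : Fin 2) : 0 ≤ bad i := by
  obtain ⟨x⟩ : Nonempty PairIndex := ⟨⟨0, by norm_num⟩⟩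
  obtain ⟨C, -, hbest⟩ := hG.isBad x i
  obtain ⟨A, hA, hf, -, h⟩ := ((isBest_iff _ _ _).1 hbest).1
  rw [h]
  exact B.obj_nonneg _ _ (hG.isInstance_gadget x i) hA hf

theorem disjoint_gadgetUnion (hG : IsGadgetFamily B P G m s opt bad) {T : Finset PairIndex}
    (k : PairIndex → Fin 2) {x : PairIndex} (hx : x ∉ T) :
    Disjoint (G x (k x)) (gadgetUnion G T k) := by
  rw [gadgetUnion, disjoint_biUnion_right]
  exact fun y hy => hG.disjoint x y (fun h => hx (h ▸ hy)) _ _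

/-- Solutions of a union of gadgets are the combinations of solutions of the gadgets. -/
theorem feasible_gadgetUnion (hG : IsGadgetFamily B P G m s opt bad) (hB : B.Additive)
    {T : Finset PairIndex} (hT : T.Nonempty) (k : PairIndex → Fin 2)
    (A : PairIndex → Finset U) (hA : ∀ x ∈ T, A x ⊆ G x (k x)) :
    (B.Feasible (gadgetUnion G T k) (T.biUnion A) ↔ ∀ x ∈ T, B.Feasible (G x (k x)) (A x)) ∧
    ((∀ x ∈ T, B.Feasible (G x (k x)) (A x)) →
      B.obj (gadgetUnion G T k) (T.biUnion A) = ∑ x ∈ T, B.obj (G x (k x)) (A x)) := by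
  induction hT using Finset.Nonempty.cons_induction with
  | singleton x => simp [gadgetUnion]
  | cons x T hx hT ih =>
    have ih := ih (fun y hy => hA y (mem_cons_of_mem hy))
    have hu : gadgetUnion G (cons x T hx) k = G x (k x) ∪ gadgetUnion G T k := by
      simp [gadgetUnion]
    have hv : (cons x T hx).biUnion A = A x ∪ T.biUnion A := by simp
    have hi := hG.isInstance (cons x T hx) k (cons_nonempty hx)
    rw [← gadgetUnion, hu] at hi
    have hadd := hB (G x (k x)) (gadgetUnion G T k) (A x) (T.biUnion A)
      (hG.isInstance_gadget x _) (hG.isInstance T k hT) hi (hG.disjoint_gadgetUnion k hx)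
      (hA x (mem_cons_self x T)) (biUnion_mono fun y hy => hA y (mem_cons_of_mem hy))
    rw [hu, hv, hadd.1, ih.1, forall_mem_cons, sum_cons]
    refine ⟨Iff.rfl, fun h => ?_⟩
    rw [hadd.2 h.1 (ih.1.2 h.2), ih.2 h.2]

theorem biUnion_inter_gadget (T : Finset PairIndex) (k : PairIndex → Fin 2) {A : Finset U}
    (hA : A ⊆ gadgetUnion G T k) : T.biUnion (fun x => A ∩ G x (k x)) = A := by
  rw [← inter_biUnion]
  exact inter_eq_left.2 hA

theorem isOpt_gadgetUnion (hG : IsGadgetFamily B P G m s opt bad) (hB : B.Additive)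
    {T : Finset PairIndex} (hT : T.Nonempty) (k : PairIndex → Fin 2) :
    B.IsOpt (gadgetUnion G T k) (∑ x ∈ T, opt (k x)) := by
  refine (isBest_iff _ _ _).2 ⟨?_, ?_⟩
  · choose A hA hf hv using fun x => ((isBest_iff _ _ _).1 (hG.isOpt x (k x))).1
    have h := hG.feasible_gadgetUnion hB hT k A (fun x _ => hA x)
    refine ⟨T.biUnion A, biUnion_mono fun x _ => hA x, h.1.2 fun x _ => hf x, ?_⟩
    rw [h.2 fun x _ => hf x]
    exact sum_congr rfl fun x _ => hv x
  · rintro w ⟨A, hA, hf, rfl⟩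
    have h := hG.feasible_gadgetUnion hB hT k (fun x => A ∩ G x (k x))
      (fun x _ => inter_subset_right)
    rw [biUnion_inter_gadget T k hA] at h
    have hf' := h.1.1 hf
    rw [h.2 hf', mul_sum, mul_sum]
    exact sum_le_sum fun x hx => hG.sign_mul_opt_le inter_subset_right (hf' x hx)

open Classical in
/-- A solution of a union of gadgets loses at least one on each gadget with a wrong decision on the
first item. -/
theorem sign_mul_obj_ge (hG : IsGadgetFamily B P G m s opt bad) (hB : B.Additive)
    {T : Finset PairIndex} (hT : T.Nonempty) (k : PairIndex → Fin 2) {o : ℝ}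
    (ho : ∀ i, opt i = o) (hb : ∀ i, B.goal.sign * bad i = B.goal.sign * o + 1)
    {A : Finset U} (hA : A ⊆ gadgetUnion G T k) (hf : B.Feasible (gadgetUnion G T k) A) :
    B.goal.sign * (T.card * o) +
      (T.filter (fun x => ¬ (m x ∈ A ↔ OptAccepts B G m x (k x)))).card ≤
      B.goal.sign * B.obj (gadgetUnion G T k) A := by
  have h := hG.feasible_gadgetUnion hB hT k (fun x => A ∩ G x (k x))
    (fun x _ => inter_subset_right)
  rw [biUnion_inter_gadget T k hA] at h
  have hf' := h.1.1 hf
  have hL : B.goal.sign * (T.card * o) +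
      (T.filter (fun x => ¬ (m x ∈ A ↔ OptAccepts B G m x (k x)))).card =
      ∑ x ∈ T, (B.goal.sign * o +
        if ¬ (m x ∈ A ↔ OptAccepts B G m x (k x)) then (1 : ℝ) else 0) := by
    rw [sum_add_distrib, sum_const, sum_boole, nsmul_eq_mul]
    ring
  rw [hL, h.2 hf', mul_sum]
  refine sum_le_sum fun x hx => ?_
  split_ifs with hw
  · rw [add_zero, ← ho (k x)]
    exact hG.sign_mul_opt_le inter_subset_right (hf' x hx)
  · rw [← hb (k x)]
    refine hG.sign_mul_bad_le inter_subset_right (hf' x hx) ?_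
    simpa [hG.first_mem x (k x)] using hw

theorem m_injective (hG : IsGadgetFamily B P G m s opt bad) : Function.Injective m := by
  intro x y hxy
  by_contra hne
  exact disjoint_left.1 (hG.disjoint x y hne 0 0) (hG.first_mem x 0) (hxy ▸ hG.first_mem y 0)

theorem m_mem_gadgetUnion (hG : IsGadgetFamily B P G m s opt bad) {T : Finset PairIndex}
    (k : PairIndex → Fin 2) {x : PairIndex} (hx : x ∈ T) : m x ∈ gadgetUnion G T k :=
  mem_biUnion.2 ⟨x, hx, hG.first_mem x _⟩

/-- Guarantees that the input is large enough for the asymptotic advice bound to apply. -/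
theorem card_le_card_gadgetUnion (hG : IsGadgetFamily B P G m s opt bad) (T : Finset PairIndex)
    (k : PairIndex → Fin 2) : T.card ≤ (gadgetUnion G T k).card :=
  card_le_card_of_injOn m (fun _ hx => hG.m_mem_gadgetUnion k hx) hG.m_injective.injOn

theorem card_gadgetUnion_le (hG : IsGadgetFamily B P G m s opt bad) (T : Finset PairIndex)
    (k : PairIndex → Fin 2) : (gadgetUnion G T k).card ≤ T.card * s :=
  card_biUnion_le_card_mul _ _ _ fun x _ => hG.size x _

theorem size_pos (hG : IsGadgetFamily B P G m s opt bad) : 0 < s := by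
  obtain ⟨x⟩ : Nonempty PairIndex := ⟨⟨0, by norm_num⟩⟩
  exact (card_pos.2 ⟨_, hG.first_mem x 0⟩).trans_le (hG.size x 0)

/-- What has arrived when the first item of the pair `x` arrives depends only on the gadgets whose
first item arrives earlier. -/
theorem filter_gadgetUnion_congr (hG : IsGadgetFamily B P G m s opt bad)
    (hP : Function.Injective P) {T : Finset PairIndex} {k l : PairIndex → Fin 2} {x : PairIndex}
    (h : ∀ y ∈ T, P (m x) < P (m y) → k y = l y) :
    (gadgetUnion G T k).filter (fun v => P (m x) ≤ P v) ⊆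
      (gadgetUnion G T l).filter (fun v => P (m x) ≤ P v) := by
  intro v hv
  rw [mem_filter, gadgetUnion, mem_biUnion] at hv
  obtain ⟨⟨y, hy, hvy⟩, hPv⟩ := hv
  refine mem_filter.2 ⟨mem_biUnion.2 ⟨y, hy, ?_⟩, hPv⟩
  have hmax := hG.first_max y _ v hvy
  rcases (hPv.trans hmax).lt_or_eq with hlt | heq
  · rwa [← h y hy hlt]
  -- Now `v` has the priority of `m y`, hence is `m y`, an item of both gadgets of `y`.
  · have : v = m y := hP (le_antisymm hmax (heq ▸ hPv))
    exact this ▸ hG.first_mem y _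

end IsGadgetFamily

/-! ### Decoding inputs from advice and errors, and counting -/

/-- The choice of gadgets that is encoded by a set of pairs. -/
def choiceOf (K : Finset PairIndex) (x : PairIndex) : Fin 2 := if x ∈ K then 1 else 0

theorem choiceOf_eq_iff (K L : Finset PairIndex) (x : PairIndex) :
    choiceOf K x = choiceOf L x ↔ (x ∈ K ↔ x ∈ L) := by
  unfold choiceOf
  split_ifs <;> simp_all

open Classical in
/-- The pairs on whose first item the algorithm makes a wrong decision. -/
noncomputable def errors (ALG : FixedPriorityAlgorithm U) (B : Problem U)
    (G : PairIndex → Fin 2 → Finset U) (m : PairIndex → U) (T : Finset PairIndex)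
    (k : PairIndex → Fin 2) : Finset PairIndex :=
  T.filter (fun x =>
    ¬ (m x ∈ ALG.accepted (gadgetUnion G T k) ↔ OptAccepts B G m x (k x)))

/-- The advice bits read and the set of wrong decisions determine the input. -/
theorem eq_of_errors_eq {ALG : FixedPriorityAlgorithm U}
    (hG : IsGadgetFamily B ALG.prio G m s opt bad) {T K K' : Finset PairIndex} (hK : K ⊆ T)
    (hK' : K' ⊆ T)
    (hadv : ∀ i < ALG.bitsRead (gadgetUnion G T (choiceOf K)),
      ALG.oracle (gadgetUnion G T (choiceOf K)) i = ALG.oracle (gadgetUnion G T (choiceOf K')) i)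
    (herr : errors ALG B G m T (choiceOf K) = errors ALG B G m T (choiceOf K')) : K = K' := by
  classical
  by_contra hne
  have hD : (T.filter (fun x => ¬ (x ∈ K ↔ x ∈ K'))).Nonempty := by
    by_contra hempty
    rw [not_nonempty_iff_eq_empty, filter_eq_empty_iff] at hempty
    refine hne (Finset.ext fun x => ⟨fun hx => ?_, fun hx => ?_⟩)
    · exact (not_not.1 (hempty (hK hx))).1 hx
    · exact (not_not.1 (hempty (hK' hx))).2 hx
  -- Highest priority means earliest arrival: `x` is the first pair on which the choices differ.
  obtain ⟨x, hx, hmax⟩ := exists_max_image _ (fun x => ALG.prio (m x)) hD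
  rw [mem_filter] at hx
  have hagree : ∀ y ∈ T, ALG.prio (m x) < ALG.prio (m y) → choiceOf K y = choiceOf K' y := by
    intro y hy hlt
    rw [choiceOf_eq_iff]
    by_contra hyne
    exact (hmax y (mem_filter.2 ⟨hy, hyne⟩)).not_gt hlt
  have hhist : (gadgetUnion G T (choiceOf K)).filter (fun v => ALG.prio (m x) ≤ ALG.prio v) =
      (gadgetUnion G T (choiceOf K')).filter (fun v => ALG.prio (m x) ≤ ALG.prio v) :=
    (hG.filter_gadgetUnion_congr ALG.prio_injective hagree).antisymm
      (hG.filter_gadgetUnion_congr ALG.prio_injective fun y hy hlt => (hagree y hy hlt).symm)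
  have hans := (ALG.depends_on_read _ _ _ fun i hi =>
    hadv i (hi.trans_le (ALG.bits_mono _ _ (m x)))).2
  have hacc : m x ∈ ALG.accepted (gadgetUnion G T (choiceOf K)) ↔
      m x ∈ ALG.accepted (gadgetUnion G T (choiceOf K')) := by
    simp only [FixedPriorityAlgorithm.accepted, mem_filter, hG.m_mem_gadgetUnion _ hx.1, true_and]
    rw [← hhist, hans]
  have hmem : x ∈ errors ALG B G m T (choiceOf K) ↔ x ∈ errors ALG B G m T (choiceOf K') := by
    rw [herr]
  simp only [errors, mem_filter, hx.1, true_and, hacc] at hmem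
  refine hx.2 ((choiceOf_eq_iff K K' x).1 (hG.eq_of_optAccepts_iff (x := x) ?_))
  tauto

/-- With few advice bits there is a choice of gadgets with many wrong decisions. -/
theorem exists_errors_gt {ALG : FixedPriorityAlgorithm U}
    (hG : IsGadgetFamily B ALG.prio G m s opt bad) {T : Finset PairIndex} (hT : T.Nonempty)
    {ε : ℝ} (hε : ε ∈ Set.Ioo (0 : ℝ) (1 / 2))
    (hbits : ∀ k, (ALG.bitsRead (gadgetUnion G T k) : ℝ) ≤ (1 - H ε) * T.card / 2) :
    ∃ k, ε * T.card < (errors ALG B G m T k).card := by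
  classical
  by_contra! hcon
  set L : ℕ := ⌊(1 - H ε) * T.card / 2⌋₊ with hL
  have hH : 0 < 1 - H ε := sub_pos.2 (H_lt_one hε.2.ne)
  have hN : (0 : ℝ) < T.card := Nat.cast_pos.2 (card_pos.2 hT)
  set S := T.powerset.filter (fun e => (e.card : ℝ) ≤ ε * T.card) with hS
  have hcard : T.powerset.card ≤ ((univ : Finset (Fin L → Bool)) ×ˢ S).card := by
    refine card_le_card_of_injOn
      (fun K => (fun i => ALG.oracle (gadgetUnion G T (choiceOf K)) i,
        errors ALG B G m T (choiceOf K))) ?_ ?_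
    · intro K _
      simp only [coe_product, coe_univ, Set.mem_prod, Set.mem_univ, true_and, mem_coe, hS,
        mem_filter, mem_powerset]
      exact ⟨filter_subset _ _, hcon _⟩
    · intro K hK K' hK' h
      simp only [Prod.mk.injEq] at h
      rw [mem_coe, mem_powerset] at hK hK'
      refine eq_of_errors_eq hG hK hK' (fun i hi => ?_) h.2
      -- The number of bits read varies with the input, but `L` bounds it uniformly, so a prefix of
      -- length `L` suffices.
      exact congrFun h.1 ⟨i, hi.trans_le (Nat.le_floor (hbits _))⟩
  rw [card_product, card_powerset, card_univ, Fintype.card_fun, Fintype.card_bool,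
    Fintype.card_fin] at hcard
  have h₁ : (2 : ℝ) ^ (T.card : ℝ) ≤ 2 ^ ((1 - H ε) * T.card / 2) * 2 ^ (H ε * T.card) := by
    calc (2 : ℝ) ^ (T.card : ℝ) ≤ 2 ^ (L : ℝ) * S.card := by
          rw [Real.rpow_natCast, Real.rpow_natCast]; exact_mod_cast hcard
      _ ≤ _ := by
          refine mul_le_mul (Real.rpow_le_rpow_of_exponent_le one_le_two ?_)
            (card_filter_powerset_le T hε.1 hε.2) (by positivity) (by positivity)
          exact Nat.floor_le (by positivity)
  rw [← Real.rpow_add two_pos, Real.rpow_le_rpow_left_iff one_lt_two] at h₁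
  -- The exponents give `N ≤ (1 - H ε) * N / 2 + H ε * N`, contradicting `H ε < 1`.
  nlinarith

/-- For every large `N` there is an input with optimal value `N * o` on which the algorithm loses
at least `ε * N`. -/
theorem eventually_exists_hard_input (hB : B.Additive) {ALG : FixedPriorityAlgorithm U}
    (hG : IsGadgetFamily B ALG.prio G m s opt bad) {ε : ℝ} (hε : ε ∈ Set.Ioo (0 : ℝ) (1 / 2))
    (hbits : ALG.ReadsFewerThan B (fun n : ℕ => (1 - H ε) * (n : ℝ) / (2 * (s : ℝ)))) {o : ℝ}
    (ho : ∀ i, opt i = o) (hb : ∀ i, B.goal.sign * bad i = B.goal.sign * o + 1) :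
    ∀ᶠ N : ℕ in Filter.atTop, ∃ I, B.IsInstance I ∧ B.IsOpt I (N * o) ∧
      (B.Feasible I (ALG.accepted I) →
        B.goal.sign * (N * o) + ε * N ≤ B.goal.sign * B.obj I (ALG.accepted I)) := by
  obtain ⟨N₀, hN₀⟩ := Filter.eventually_atTop.1 hbits
  filter_upwards [Filter.eventually_ge_atTop (max N₀ 1)] with N hN
  obtain ⟨hN₁, hN₂⟩ := max_le_iff.1 hN
  have : Infinite PairIndex := (Set.Icc_infinite (by norm_num)).to_subtype
  obtain ⟨T, rfl⟩ := Infinite.exists_subset_card_eq PairIndex N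
  have hT : T.Nonempty := card_pos.1 hN₂
  have hH : 0 < 1 - H ε := sub_pos.2 (H_lt_one hε.2.ne)
  have hs : (0 : ℝ) < s := Nat.cast_pos.2 hG.size_pos
  obtain ⟨k, hk⟩ := exists_errors_gt hG hT hε fun k => by
    refine (hN₀ _ (hN₁.trans (hG.card_le_card_gadgetUnion T k)) _ (hG.isInstance T k hT)
      rfl).le.trans ?_
    have hc : ((gadgetUnion G T k).card : ℝ) ≤ T.card * s := by
      exact_mod_cast hG.card_gadgetUnion_le T k
    rw [div_le_div_iff₀ (by positivity) two_pos]
    nlinarith [mul_le_mul_of_nonneg_left hc hH.le]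
  refine ⟨gadgetUnion G T k, hG.isInstance T k hT, ?_, fun hf => ?_⟩
  · simpa [ho] using hG.isOpt_gadgetUnion hB hT k
  · have h := hG.sign_mul_obj_ge hB hT k ho hb (A := ALG.accepted _) (filter_subset _ _) hf
    rw [errors] at hk
    linarith

end Gadgets

/-! ### Passage to the limit and the approximation ratio -/

/-- A linear inequality that holds for arbitrarily large `N` up to a constant holds without it. -/
theorem le_of_eventually_mul_le {a b α : ℝ}
    (h : ∀ᶠ N : ℕ in Filter.atTop, (N : ℝ) * a ≤ N * b + α) : a ≤ b := by
  by_contra! hlt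
  have ht : Filter.Tendsto (fun N : ℕ => (N : ℝ) * (a - b)) Filter.atTop Filter.atTop :=
    tendsto_natCast_atTop_atTop.atTop_mul_const (sub_pos.2 hlt)
  obtain ⟨N, h₁, h₂⟩ := (h.and (ht.eventually_gt_atTop α)).exists
  linarith

end PriorityAdvice

theorem mainTheorem4 {U : Type*} [DecidableEq U] (B : PriorityAdvice.Problem U)
    (hB : B.Additive) (ALG : PriorityAdvice.FixedPriorityAlgorithm U)
    (G : PriorityAdvice.PairIndex → Fin 2 → Finset U) (m : PriorityAdvice.PairIndex → U)
    (s : ℕ) (opt bad : Fin 2 → ℝ)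
    (hG : PriorityAdvice.IsGadgetFamily B ALG.prio G m s opt bad)
    (ε : ℝ) (hε : ε ∈ Set.Ioo (0 : ℝ) (1 / 2))
    (hbits : ALG.ReadsFewerThan B
      (fun n : ℕ => (1 - PriorityAdvice.H ε) * (n : ℝ) / (2 * (s : ℝ)))) :
    (B.goal = PriorityAdvice.Goal.minimize → 0 < opt 0 →
      opt 0 = opt 1 → opt 1 = bad 0 - 1 → bad 0 - 1 = bad 1 - 1 →
      ((1 + ε / opt 0 : ℝ) : EReal) ≤ ALG.approxRatio B) ∧
    (B.goal = PriorityAdvice.Goal.maximize →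
      opt 0 = opt 1 → opt 1 = bad 0 + 1 → bad 0 + 1 = bad 1 + 1 →
      ((1 + ε / (opt 0 - ε) : ℝ) : EReal) ≤ ALG.approxRatio B) := by
  open PriorityAdvice in
  refine ⟨fun hgoal hpos h₁ h₂ h₃ => ?_, fun hgoal h₁ h₂ h₃ => ?_⟩ <;>
  refine le_sInf ?_ <;>
  rintro _ ⟨c, ⟨α, hc⟩, rfl⟩ <;>
  rw [EReal.coe_le_coe_iff] <;>
  have hhard := eventually_exists_hard_input hB hG hε hbits (o := opt 0)
    (fun i => by fin_cases i <;> simp [h₁])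
    (fun i => by fin_cases i <;> simp only [hgoal, Goal.sign] <;> simp <;> linarith) <;>
  simp only [hgoal, Goal.sign, one_mul, FixedPriorityAlgorithm.RatioBound] at hhard hc
  · have key : opt 0 + ε ≤ c * opt 0 := by
      refine le_of_eventually_mul_le (α := α) (hhard.mono ?_)
      rintro N ⟨I, hI, hopt, hobj⟩
      have h := hc I _ hI hopt
      linarith [hobj h.1, h.2]
    rw [← div_self hpos.ne', ← add_div, div_le_iff₀ hpos]
    exact key
  · have hbad := hG.bad_nonneg 0
    have hopt_pos : 1 ≤ opt 0 := by linarith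
    have hgap : 0 < opt 0 - ε := by linarith [hε.2]
    -- For `c < 0`, nonnegative profits would bound the optimum `N * opt 0` by `α` for all large
    -- `N`.
    have hc₀ : 0 ≤ c := by
      by_contra! hneg
      have key : opt 0 ≤ 0 := by
        refine le_of_eventually_mul_le (α := α) (hhard.mono ?_)
        rintro N ⟨I, hI, hopt, -⟩
        have h := hc I _ hI hopt
        have hnn := B.obj_nonneg I (ALG.accepted I) hI (Finset.filter_subset _ _) h.1
        linarith [h.2, mul_nonneg (neg_nonneg.2 hneg.le) hnn]
      linarith
    have key : opt 0 ≤ c * (opt 0 - ε) := by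
      refine le_of_eventually_mul_le (α := α) (hhard.mono ?_)
      rintro N ⟨I, hI, hopt, hobj⟩
      have h := hc I _ hI hopt
      have hle : B.obj I (ALG.accepted I) ≤ N * (opt 0 - ε) := by linarith [hobj h.1]
      linarith [h.2, mul_le_mul_of_nonneg_left hle hc₀]
    rw [← div_self hgap.ne', ← add_div, div_le_iff₀ hgap]
    linarith
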